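/- All groups are finite and $\mathbb{N}=\{1,2,3,\dots\}$. For a group $G$, $m\in\mathbb{N}$ and $u,g\in G$ put $G_m(u,g)=\{a\in G : a^m=(au)^m=g\}$. The group $G$ is called $FSZ_m$ if $|G_m(u,g)|=|G_m(u,g^n)|$ for all $u,g\in G$ and all $n\in\mathbb{N}$ with $\gcd(n,|G|)=1$, and it is called $FSZ_m^+$ if the centralizer $C_G(g)$ is $FSZ_m$ for every $g\in G$. For a prime $p$ and $j\in\mathbb{N}$ let $Q_{p,j}=\mathbb{Z}_{p^{j+1}}\times\mathbb{Z}_p^{p^j-1}$ be the abelian group with independent generators $a_1,\dots,a_{p^j}$, where $a_1$ has order $p^{j+1}$ and the other $a_k$ have order $p$. Let $b_{p,j}$ be the automorphism of $Q_{p,j}$ with $a_1\mapsto a_1a_2^{-1}$, $a_k\mapsto a_ka_{k+1}$ for $2\le k<p^j$, and $a_{p^j}\mapsto a_{p^j}$, and let $F(p,j)=Q_{p,j}\rtimes\langle b_{p,j}\rangle$. For a group $D$ let $D\wr_r\mathbb{Z}_p=D^p\rtimes\mathbb{Z}_p$ be the regular wreath product, where $\mathbb{Z}_p$ permutes the $p$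 factors cyclically. Theorem. For every prime $p$, the group $F(p,1)\wr_r\mathbb{Z}_p$ is $FSZ_{p^t}^+$ for all integers $t>1$. -/

import Mathlib

namespace FSZ

section Basic

variable {G : Type*} [Group G]

/-- The set `G_m(u, g) = {a ∈ G : a ^ m = (a u) ^ m = g}`. -/
def powSet (m : ℕ) (u g : G) : Set G :=
  {a | a ^ m = g ∧ (a * u) ^ m = g}

variable (G)

/-- A finite group `G` is `FSZ_m` if `|G_m(u, g)| = |G_m(u, g ^ n)|` for every positive integer `n`
coprime to `|G|` and all `u, g ∈ G`. -/
def IsFSZ [Finite G] (m : ℕ) : Prop :=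
  ∀ n : ℕ, 0 < n → Nat.Coprime n (Nat.card G) →
    ∀ u g : G, (powSet m u g).ncard = (powSet m u (g ^ n)).ncard

/-- A finite group `G` is `FSZ_m⁺` if the centralizer of every element of `G` is `FSZ_m`. -/
def IsFSZPlus [Finite G] (m : ℕ) : Prop :=
  ∀ g : G, IsFSZ (Subgroup.centralizer ({g} : Set G)) m

end Basic

section FGroup

/-- The abelian group `ℤ/p^(j+1) × (ℤ/p)^(p^j - 1)`, written additively. A pair `(x, v)` stands for
`a_1 ^ x * ∏ a_(i+2) ^ (v i)`, where `i` runs over `0, …, p^j - 2`. -/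
abbrev QAdd (p j : ℕ) : Type :=
  ZMod (p ^ (j + 1)) × (Fin (p ^ j - 1) → ZMod p)

/-- Reduction `ℤ/p^(j+1) → ℤ/p`. -/
def reduce (p j : ℕ) : ZMod (p ^ (j + 1)) →+* ZMod p :=
  ZMod.castHom (dvd_pow_self p (Nat.succ_ne_zero j)) (ZMod p)

/-- The endomorphism `b` of `QAdd p j` with `a_1 ↦ a_1 a_2⁻¹`, `a_k ↦ a_k a_(k+1)` for
`2 ≤ k < p^j`, and `a_(p^j) ↦ a_(p^j)`. In coordinates, the exponent of `a_1` is kept, that of `a_2`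
becomes `v 0 - x`, and that of `a_(i+2)` becomes `v i + v (i - 1)` for `i > 0`. -/
def bHom (p j : ℕ) : QAdd p j →+ QAdd p j where
  toFun q := (q.1, fun i =>
    if (i : ℕ) = 0 then q.2 i - reduce p j q.1
    else q.2 i + q.2 ⟨(i : ℕ) - 1, lt_of_le_of_lt (Nat.sub_le _ _) i.isLt⟩)
  map_zero' := by
    ext i
    · rfl
    · simp
  map_add' q r := by
    ext i
    · rfl
    · by_cases h : (i : ℕ) = 0 <;> simp [h] <;> ring

theorem bHom_injective (p j : ℕ) : Function.Injective (bHom p j) := by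
  rw [injective_iff_map_eq_zero]
  rintro ⟨x, v⟩ h
  have hx : x = 0 := congrArg Prod.fst h
  have hv : ∀ (k : ℕ) (hk : k < p ^ j - 1), v ⟨k, hk⟩ = 0 := by
    intro k
    induction k with
    | zero =>
      intro hk
      have h0 := congrFun (congrArg Prod.snd h) ⟨0, hk⟩
      simpa [bHom, hx] using h0
    | succ k ih =>
      intro hk
      have h1 := congrFun (congrArg Prod.snd h) ⟨k + 1, hk⟩
      simpa [bHom, ih (Nat.lt_of_succ_lt hk)] using h1
  ext i
  · exact hx
  · exact hv i i.isLt

variable (p : ℕ) [hp : Fact p.Prime] (j : ℕ)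

instance neZeroPrimePow : NeZero (p ^ (j + 1)) := ⟨pow_ne_zero _ hp.out.ne_zero⟩

/-- The group `Q_{p,j}`, written multiplicatively. -/
abbrev QGroup (p j : ℕ) : Type := Multiplicative (QAdd p j)

/-- The endomorphism `b` as an automorphism `b_{p,j}` of `Q_{p,j}`. -/
noncomputable def bAut : MulAut (QGroup p j) :=
  AddEquiv.toMultiplicative
    (AddEquiv.ofBijective (bHom p j) (Finite.injective_iff_bijective.mp (bHom_injective p j)))

/-- The group `F(p,j) = Q_{p,j} ⋊ ⟨b_{p,j}⟩`. -/
abbrev FGroup : Type :=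
  QGroup p j ⋊[(Subgroup.zpowers (bAut p j)).subtype] Subgroup.zpowers (bAut p j)

instance finiteFGroup : Finite (FGroup p j) :=
  Finite.of_equiv _ SemidirectProduct.equivProd.symm

end FGroup

end FSZ

/-!
Suppose that `a ^ m` is determined by the value `φ a` of a homomorphism to an abelian group together
with the set of those homomorphisms among `ψ` and `χ`, with values in groups of prime order, that
are trivial at `a`; that `a ^ m` is homogeneous in `φ a`; and that a nontrivial `a ^ m` determines
`φ a`. Then `a ^ m = (a * u) ^ m ≠ 1` forces `φ u = 1`. For such `u` the map `a ↦ a ^ n`, which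
raises `m`-th powers to the power `n`, can be twisted into a bijection that raises `φ` to the power
`n` but does not change whether `ψ` and `χ` are trivial at `a` and at `a * u`: it raises `ψ` to the
power `n` if `ψ u = 1` and keeps it otherwise, and likewise for `χ`. This bijection maps `G_m(u, g)`
onto `G_m(u, g ^ n)`. If `ψ u` and `χ u` are both nontrivial, powers of `u` alone cannot adjust
`ψ` and `χ` independently, and one needs another element on which `φ` and `ψ` are trivial but `χ` is
not.

In `F(p,j)` the `p ^ j`-th power of `q * b ^ k` is a norm of `q`. It depends only on the exponent of
`a_1` in `q` modulo `p` and on whether `p` divides `k`. In a wreath product with a group of order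
`p`, the `p`-th power of an element outside the base group has in each coordinate the product of all
the coordinates in cyclic order, so that the hypothesis passes from `D` and `r` to the wreath
product and `p * r`, the homomorphism `χ` being the projection to the group of order `p`. It also
passes to centralizers: that of an element outside the base group meets the base group in the kernel
of `φ`, and in that of a base element one can multiply `u` by a base element supported on a single
coordinate to make `φ` and `ψ` trivial. The exponents `p ^ t` beyond `p * p ^ j` kill the whole
group.
-/

namespace FSZ

section Criterion

variable {G A B E σ : Type*} [Group G] [Group A] [Group B] [Group E]

theorem pow_ne_one_of_coprime_natCard {n : ℕ} (hn : n.Coprime (Nat.card G)) {g : G} (hg : g ≠ 1) :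
    g ^ n ≠ 1 :=
  fun hgn => hg ((powCoprime hn.symm).injective (by simpa using hgn))

theorem isFSZ_of_pow_eq_one [Finite G] {m : ℕ} (h : ∀ a : G, a ^ m = 1) : IsFSZ G m := by
  intro n _ hn u g
  rcases eq_or_ne g 1 with rfl | hg
  · rw [one_pow]
  · simp [powSet, h, hg.symm, (pow_ne_one_of_coprime_natCard hn hg).symm]

theorem isFSZPlus_of_pow_eq_one [Finite G] {m : ℕ} (h : ∀ a : G, a ^ m = 1) : IsFSZPlus G m :=
  fun _ => isFSZ_of_pow_eq_one fun a => Subtype.ext (h a)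

theorem ncard_powSet_eq_of_bijective {m n : ℕ} {u : G} (hn : Function.Injective fun a : G => a ^ n)
    {θ : G → G} (hθ : Function.Bijective θ) (hpow : ∀ a, θ a ^ m = (a ^ m) ^ n)
    (hpowu : ∀ a, (θ a * u) ^ m = ((a * u) ^ m) ^ n) (g : G) :
    (powSet m u g).ncard = (powSet m u (g ^ n)).ncard := by
  have himage : θ '' powSet m u g = powSet m u (g ^ n) := by
    ext c
    obtain ⟨a, rfl⟩ := hθ.2 c
    rw [hθ.1.mem_set_image]
    simp only [powSet, Set.mem_ofPred_eq, hpow, hpowu]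
    exact and_congr hn.eq_iff.symm hn.eq_iff.symm
  rw [← himage, Set.ncard_image_of_injective _ hθ.1]

/-- The lift moves each fibre of `f` by a single left translation. -/
theorem exists_bijective_lift [Finite G] (f : G →* A) {τ : A → A}
    (hτ : Set.InjOn τ (Set.range f)) (hmaps : Set.MapsTo τ (Set.range f) (Set.range f)) :
    ∃ θ : G → G, Function.Bijective θ ∧ ∀ a, f (θ a) = τ (f a) := by
  have htranslate (v : Set.range f) : ∃ c : G, f c * v = τ v := by
    obtain ⟨_, a, rfl⟩ := v
    obtain ⟨c, hc⟩ := hmaps ⟨a, rfl⟩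
    exact ⟨c * a⁻¹, by simp [hc]⟩
  choose s hs using htranslate
  have hlift (a : G) : f (s ⟨f a, a, rfl⟩ * a) = τ (f a) := by rw [map_mul, hs]
  refine ⟨fun a => s ⟨f a, a, rfl⟩ * a, Finite.injective_iff_bijective.mp fun a b hab => ?_, hlift⟩
  have hfab : f a = f b := hτ ⟨a, rfl⟩ ⟨b, rfl⟩ (by rw [← hlift, ← hlift]; exact congrArg f hab)
  simpa [hfab] using hab

theorem map_eq_of_map_pow_eq {n : ℕ} (hn : n.Coprime (Nat.card G)) (f : G →* A) {a b : G}
    (h : f a ^ n = f b ^ n) : f a = f b := by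
  have hcop : (Nat.card f.range).Coprime n :=
    (hn.coprime_dvd_right (Subgroup.card_range_dvd f)).symm
  exact congrArg Subtype.val
    ((powCoprime hcop).injective (Subtype.ext h : f.rangeRestrict a ^ n = f.rangeRestrict b ^ n))

theorem exists_map_mul_pow_eq (hB : (Nat.card B).Prime) (f : G →* B) {u : G} (hu : f u ≠ 1)
    (a : G) (b : B) : ∃ k : ℕ, f (a * u ^ k) = b := by
  have : Fact (Nat.card B).Prime := ⟨hB⟩
  obtain ⟨k, hk⟩ := Submonoid.mem_powers_iff _ _ |>.mp
    (mem_powers_of_prime_card rfl hu (g' := (f a)⁻¹ * b))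
  exact ⟨k, by rw [map_mul, map_pow, hk, mul_inv_cancel_left]⟩

open Classical in
/-- The exponent `1` or `n` such that `x ↦ x ^ twistExp n b` keeps track of both whether `x` and
whether `x * b` is trivial, for `n` coprime to the order of the group. -/
noncomputable def twistExp (n : ℕ) (b : B) : ℕ := if b = 1 then n else 1

theorem map_eq_of_map_pow_twistExp_eq {n : ℕ} (hn : n.Coprime (Nat.card G)) (f : G →* B)
    (b : B) {a a' : G} (h : f a ^ twistExp n b = f a' ^ twistExp n b) : f a = f a' := by
  refine map_eq_of_map_pow_eq (n := twistExp n b) ?_ f h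
  unfold twistExp
  split_ifs
  · exact hn
  · exact Nat.coprime_one_left _

theorem map_pow_twistExp_eq_one_iff {n : ℕ} (hn : n.Coprime (Nat.card G)) (f : G →* B)
    (b : B) (a : G) : f a ^ twistExp n b = 1 ↔ f a = 1 :=
  ⟨fun h => by
    simpa using map_eq_of_map_pow_twistExp_eq hn f b (a := a) (a' := 1) (by simpa using h),
    fun h => by rw [h, one_pow]⟩

theorem map_pow_twistExp_mul_eq_one_iff {n : ℕ} (hn : n.Coprime (Nat.card G)) (f : G →* B)
    (b : B) (a : G) : f a ^ twistExp n b * b = 1 ↔ f a * b = 1 := by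
  by_cases hb : b = 1
  · rw [hb, mul_one, mul_one, map_pow_twistExp_eq_one_iff hn]
  · rw [twistExp, if_neg hb, pow_one]

/-- The `m`-th power of `a` is determined by the value of the homomorphism `φ` together with the
pattern `s a`; it varies homogeneously with `φ a` as long as the pattern is fixed, and it determines
`φ a` unless it is trivial. Typically `s a` records which members of a family of homomorphisms
are trivial at `a`. -/
structure PowGovernedBy (m : ℕ) (φ : G →* A) (s : G → σ) : Prop where
  pow_eq_pow : ∀ (n : ℕ) {a b : G}, φ b = φ a ^ n → s b = s a → b ^ m = (a ^ m) ^ n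
  map_eq : ∀ {a b : G}, a ^ m = b ^ m → a ^ m ≠ 1 → φ a = φ b

namespace PowGovernedBy

variable {m : ℕ} {φ : G →* A} {s : G → σ}

theorem pow_eq_one (h : PowGovernedBy m φ s) {a : G} (ha : φ a = 1) : a ^ m = 1 := by
  simpa using h.pow_eq_pow 0 (a := a) (by simpa using ha) rfl

theorem pow_pow_eq_one (h : PowGovernedBy m φ s) {n : ℕ} {a : G} (ha : φ a ^ n = 1) :
    (a ^ m) ^ n = 1 := by
  have hsucc : a ^ m = (a ^ m) ^ (n + 1) := h.pow_eq_pow (n + 1) (by rw [pow_succ, ha, one_mul]) rfl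
  rwa [pow_succ, right_eq_mul] at hsucc

theorem restrict (h : PowGovernedBy m φ s) (H : Subgroup G) :
    PowGovernedBy m (φ.comp H.subtype) fun a => s a where
  pow_eq_pow n _ _ hφ hs := Subtype.ext (h.pow_eq_pow n hφ hs)
  map_eq hab ha := h.map_eq (congrArg Subtype.val hab) fun h1 => ha (Subtype.ext h1)

theorem powSet_eq_empty (h : PowGovernedBy m φ s) {u g : G} (hu : φ u ≠ 1) (hg : g ≠ 1) :
    powSet m u g = ∅ := by
  refine Set.eq_empty_of_forall_notMem fun a ⟨ha, hau⟩ => hu ?_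
  simpa using h.map_eq (hau.trans ha.symm) (hau ▸ hg)

end PowGovernedBy

theorem exists_map_eq_pow_twistExp {φ : G →* A} {ψ : G →* B} {χ : G →* E}
    (hB : (Nat.card B).Prime) (hE : (Nat.card E).Prime) {u : G} (hu : φ u = 1)
    (hw : ψ u ≠ 1 → χ u ≠ 1 → ∃ w, φ w = 1 ∧ ψ w = 1 ∧ χ w ≠ 1) (n : ℕ) (a : G) :
    ∃ c, φ c = φ a ^ n ∧ ψ c = ψ a ^ twistExp n (ψ u) ∧ χ c = χ a ^ twistExp n (χ u) := by
  by_cases hψ : ψ u = 1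
  · by_cases hχ : χ u = 1
    · exact ⟨a ^ n, by simp [twistExp, hψ, hχ]⟩
    · obtain ⟨k, hk⟩ := exists_map_mul_pow_eq hE χ hχ (a ^ n) (χ a ^ twistExp n (χ u))
      exact ⟨a ^ n * u ^ k, by simp [hu], by simp [twistExp, hψ], hk⟩
  · obtain ⟨k, hk⟩ := exists_map_mul_pow_eq hB ψ hψ (a ^ n) (ψ a ^ twistExp n (ψ u))
    by_cases hχ : χ u = 1
    · exact ⟨a ^ n * u ^ k, by simp [hu], hk, by simp [twistExp, hχ]⟩
    · obtain ⟨w, hφw, hψw, hχw⟩ := hw hψ hχ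
      obtain ⟨l, hl⟩ := exists_map_mul_pow_eq hE χ hχw (a ^ n * u ^ k) (χ a ^ twistExp n (χ u))
      exact ⟨a ^ n * u ^ k * w ^ l, by simp [hu, hφw], by simp [hψw, ← hk], hl⟩

theorem exists_bijective_map_eq_pow_twistExp [Finite G] {φ : G →* A} {ψ : G →* B} {χ : G →* E}
    (hB : (Nat.card B).Prime) (hE : (Nat.card E).Prime) {u : G} (hu : φ u = 1)
    (hw : ψ u ≠ 1 → χ u ≠ 1 → ∃ w, φ w = 1 ∧ ψ w = 1 ∧ χ w ≠ 1) {n : ℕ}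
    (hn : n.Coprime (Nat.card G)) :
    ∃ θ : G → G, Function.Bijective θ ∧ ∀ a, φ (θ a) = φ a ^ n ∧
      ψ (θ a) = ψ a ^ twistExp n (ψ u) ∧ χ (θ a) = χ a ^ twistExp n (χ u) := by
  obtain ⟨θ, hθ, hlift⟩ := exists_bijective_lift (φ.prod (ψ.prod χ))
    (τ := fun v => (v.1 ^ n, v.2.1 ^ twistExp n (ψ u), v.2.2 ^ twistExp n (χ u))) (by
      rintro _ ⟨a, rfl⟩ _ ⟨b, rfl⟩ hab
      simp only [MonoidHom.prod_apply, Prod.mk.injEq] at hab ⊢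
      exact ⟨map_eq_of_map_pow_eq hn φ hab.1, map_eq_of_map_pow_twistExp_eq hn ψ _ hab.2.1,
        map_eq_of_map_pow_twistExp_eq hn χ _ hab.2.2⟩) (by
      rintro _ ⟨a, rfl⟩
      obtain ⟨c, hφ, hψ, hχ⟩ := exists_map_eq_pow_twistExp hB hE hu hw n a
      exact ⟨c, by simp [hφ, hψ, hχ]⟩)
  exact ⟨θ, hθ, fun a => by simpa only [MonoidHom.prod_apply, Prod.mk.injEq] using hlift a⟩

theorem isFSZ_of_powGovernedBy [Finite G] {m : ℕ} {φ : G →* A} {ψ : G →* B} {χ : G →* E}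
    (hB : (Nat.card B).Prime) (hE : (Nat.card E).Prime)
    (h : PowGovernedBy m φ fun a => (ψ a = 1, χ a = 1))
    (hw : ∀ a u : G, a ^ m ≠ 1 → φ u = 1 → ψ u ≠ 1 → χ u ≠ 1 → ∃ w, φ w = 1 ∧ ψ w = 1 ∧ χ w ≠ 1) :
    IsFSZ G m := by
  by_cases htriv : ∀ a : G, a ^ m = 1
  · exact isFSZ_of_pow_eq_one htriv
  obtain ⟨a₀, ha₀⟩ := not_forall.mp htriv
  intro n _ hn u g
  by_cases hu : φ u = 1
  · obtain ⟨θ, hθ, hmap⟩ :=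
      exists_bijective_map_eq_pow_twistExp hB hE hu (hw a₀ u ha₀ hu) hn
    refine ncard_powSet_eq_of_bijective (powCoprime hn.symm).injective hθ
      (fun a => ?_) (fun a => ?_) g <;> obtain ⟨hφ, hψ, hχ⟩ := hmap a
    · refine h.pow_eq_pow n hφ ?_
      simp only [hψ, hχ, map_pow_twistExp_eq_one_iff hn]
    · refine h.pow_eq_pow n (by simp [hφ, hu]) ?_
      simp only [map_mul, hψ, hχ, map_pow_twistExp_mul_eq_one_iff hn]
  · rcases eq_or_ne g 1 with rfl | hg
    · rw [one_pow]
    · rw [h.powSet_eq_empty hu hg,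
        h.powSet_eq_empty hu (pow_ne_one_of_coprime_natCard hn hg)]

end Criterion

section PowNorm

variable {N H : Type*} [CommGroup N] [Group H]

/-- The product `q ↦ q * c q * c² q * ⋯ * c ^ (n - 1) q`: the `n`-th power of `(q, c)` in the
semidirect product, and the norm of `q` if `c` has order `n`. -/
def powNorm (n : ℕ) (c : MulAut N) : N →* N := ∏ i ∈ Finset.range n, ((c ^ i : MulAut N) : N →* N)

theorem powNorm_apply (n : ℕ) (c : MulAut N) (q : N) :
    powNorm n c q = ∏ i ∈ Finset.range n, (c ^ i) q :=
  MonoidHom.finsetProd_apply _ _ _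

theorem powNorm_mul_of_pow_eq_one {n : ℕ} {c : MulAut N} (hc : c ^ n = 1) (k : ℕ) (q : N) :
    powNorm (n * k) c q = powNorm n c q ^ k := by
  induction k with
  | zero => simp [powNorm_apply]
  | succ k ih =>
    have hperiod (i : ℕ) : c ^ (n * k + i) = c ^ i := by rw [pow_add, pow_mul, hc, one_pow, one_mul]
    rw [powNorm_apply, Nat.mul_succ, Finset.prod_range_add, ← powNorm_apply, ih, pow_succ]
    simp only [hperiod, powNorm_apply]

theorem image_range_mul_mod {n k : ℕ} (hk : k.Coprime n) :
    (Finset.range n).image (fun i => k * i % n) = Finset.range n := by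
  refine Finset.eq_of_subset_of_card_le (fun r hr => ?_) (Finset.card_image_of_injOn ?_).ge
  · obtain ⟨i, hi, rfl⟩ := Finset.mem_image.mp hr
    exact Finset.mem_range.mpr (Nat.mod_lt _ (Nat.zero_lt_of_lt (Finset.mem_range.mp hi)))
  · intro i hi i' hi' hii'
    exact (Nat.ModEq.cancel_left_of_coprime hk.symm hii').eq_of_lt_of_lt
      (Finset.mem_range.mp hi) (Finset.mem_range.mp hi')

theorem powNorm_pow_of_coprime {n k : ℕ} {c : MulAut N} (hc : c ^ n = 1) (hk : k.Coprime n) :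
    powNorm n (c ^ k) = powNorm n c := by
  have hinj : Set.InjOn (fun i => k * i % n) (Finset.range n) :=
    Finset.card_image_iff.mp (by rw [image_range_mul_mod hk])
  calc powNorm n (c ^ k)
      = ∏ i ∈ Finset.range n, ((c ^ (k * i % n) : MulAut N) : N →* N) := by
        simp only [powNorm, ← pow_mul, ← pow_eq_pow_mod _ hc]
    _ = powNorm n c := by
        rw [← Finset.prod_image (f := fun i => ((c ^ i : MulAut N) : N →* N)) hinj,
          image_range_mul_mod hk, powNorm]

theorem pow_eq_inl_powNorm {φ : H →* MulAut N} {y : N ⋊[φ] H} {n : ℕ} (hy : y.right ^ n = 1) :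
    y ^ n = SemidirectProduct.inl (powNorm n (φ y.right) y.left) := by
  have hright (k : ℕ) : (y ^ k).right = y.right ^ k := map_pow SemidirectProduct.rightHom y k
  have hleft (k : ℕ) : (y ^ k).left = powNorm k (φ y.right) y.left := by
    induction k with
    | zero => simp [powNorm_apply]
    | succ k ih =>
      rw [pow_succ, SemidirectProduct.mul_left, hright, ih, powNorm_apply, powNorm_apply,
        Finset.prod_range_succ, map_pow]
  ext1
  · rw [hleft, SemidirectProduct.left_inl]
  · rw [hright, hy, SemidirectProduct.right_inl]

end PowNorm

section Wreath

variable {D Q A B : Type*} [Group D] [Group Q] [CommGroup A] [CommGroup B]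

theorem wreath_right_pow (a : D ≀ᵣ Q) (k : ℕ) : (a ^ k).right = a.right ^ k :=
  map_pow RegularWreathProduct.rightHom a k

theorem wreath_left_pow_of_right_eq_one {a : D ≀ᵣ Q} (ha : a.right = 1) (k : ℕ) :
    (a ^ k).left = a.left ^ k := by
  induction k with
  | zero => simp
  | succ k ih => simp [pow_succ, ih, wreath_right_pow, ha]

theorem map_wreath_left_pow (φ : D →* A) (a : D ≀ᵣ Q) (k : ℕ) (x : Q) :
    φ ((a ^ k).left x) = ∏ i ∈ Finset.range k, φ (a.left ((a.right ^ i)⁻¹ * x)) := by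
  induction k with
  | zero => simp
  | succ k ih =>
    rw [pow_succ, RegularWreathProduct.mul_left, Pi.mul_apply, map_mul, ih, wreath_right_pow,
      Finset.prod_range_succ]

theorem wreath_right_pow_natCard (a : D ≀ᵣ Q) : (a ^ Nat.card Q).right = 1 := by
  rw [wreath_right_pow, pow_card_eq_one']

theorem wreath_right_pow_natCard_mul (a : D ≀ᵣ Q) (k : ℕ) : (a ^ (Nat.card Q * k)).right = 1 := by
  rw [pow_mul, wreath_right_pow, wreath_right_pow_natCard, one_pow]

theorem wreath_left_pow_natCard_mul (a : D ≀ᵣ Q) (k : ℕ) (x : Q) :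
    (a ^ (Nat.card Q * k)).left x = (a ^ Nat.card Q).left x ^ k := by
  rw [pow_mul, wreath_left_pow_of_right_eq_one (wreath_right_pow_natCard a), Pi.pow_apply]

theorem exists_wreath_left_pow_natCard_mul_ne_one {a : D ≀ᵣ Q} {k : ℕ}
    (ha : a ^ (Nat.card Q * k) ≠ 1) : ∃ x, (a ^ (Nat.card Q * k)).left x ≠ 1 := by
  by_contra! hone
  exact ha (RegularWreathProduct.ext (funext hone) (wreath_right_pow_natCard_mul a k))

theorem PowGovernedBy.wreath_pow_eq_one {σ : Type*} (hA : ∀ x : A, x ^ Nat.card Q = 1) {r : ℕ}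
    {φ : D →* A} {s : D → σ} (h : PowGovernedBy r φ s) {a : D ≀ᵣ Q} (ha : a.right = 1) :
    a ^ (Nat.card Q * r) = 1 := by
  refine RegularWreathProduct.ext (funext fun x => ?_) (wreath_right_pow_natCard_mul a r)
  rw [wreath_left_pow_of_right_eq_one ha, Pi.pow_apply, mul_comm, pow_mul]
  exact h.pow_pow_eq_one (hA _)

variable [Fintype Q]

theorem prod_range_pow_natCard {z : Q} (hz : ∀ x, x ∈ Subgroup.zpowers z) (f : Q → A) :
    ∏ i ∈ Finset.range (Nat.card Q), f (z ^ i) = ∏ x, f x := by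
  classical
  rw [← IsCyclic.image_range_card hz, Finset.prod_image]
  rw [← orderOf_eq_card_of_forall_mem_zpowers hz, Finset.coe_range]
  exact pow_injOn_Iio_orderOf

/-- The homomorphism `a ↦ ∏ x, φ (a x)` on a wreath product. It is invariant under the action of
`Q` on the base group as `A` is commutative. -/
def prodHom (φ : D →* A) : D ≀ᵣ Q →* A where
  toFun a := ∏ x, φ (a.left x)
  map_one' := by simp
  map_mul' a b := by
    simp only [RegularWreathProduct.mul_left, Pi.mul_apply, map_mul, Finset.prod_mul_distrib]
    congr 1
    exact Fintype.prod_equiv (Equiv.mulLeft a.right⁻¹) _ _ fun x => rfl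

theorem prodHom_apply (φ : D →* A) (a : D ≀ᵣ Q) : prodHom φ a = ∏ x, φ (a.left x) := rfl

open Classical in
theorem prodHom_mulSingle (φ : D →* A) (x : Q) (d : D) :
    prodHom φ ⟨Pi.mulSingle x d, 1⟩ = φ d := by
  rw [prodHom_apply, Fintype.prod_eq_single x fun y hy => by simp [Pi.mulSingle_eq_of_ne hy]]
  simp

section PrimeOrder

variable [Fact (Nat.card Q).Prime]

theorem map_wreath_left_pow_natCard (φ : D →* A) {a : D ≀ᵣ Q} (ha : a.right ≠ 1) (x : Q) :
    φ ((a ^ Nat.card Q).left x) = prodHom φ a := by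
  have hgen (z : Q) : z ∈ Subgroup.zpowers a.right := mem_zpowers_of_prime_card rfl ha
  rw [map_wreath_left_pow, prod_range_pow_natCard hgen fun z => φ (a.left (z⁻¹ * x)), prodHom_apply]
  exact Fintype.prod_equiv ((Equiv.inv Q).trans (Equiv.mulRight x)) _ _ fun _ => rfl

theorem PowGovernedBy.wreath (hA : ∀ x : A, x ^ Nat.card Q = 1) {r : ℕ} {φ : D →* A}
    {ι : D →* B} (h : PowGovernedBy r φ fun y => ι y = 1) :
    PowGovernedBy (Nat.card Q * r) (prodHom (Q := Q) φ)
      fun a => (prodHom ι a = 1, a.right = 1) where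
  pow_eq_pow n a b hφ hs := by
    obtain ⟨hι, hright⟩ : (prodHom ι b = 1 ↔ prodHom ι a = 1) ∧ (b.right = 1 ↔ a.right = 1) := by
      simpa only [Prod.mk.injEq, eq_iff_iff] using hs
    by_cases ha : a.right = 1
    · rw [h.wreath_pow_eq_one hA ha, h.wreath_pow_eq_one hA (hright.mpr ha), one_pow]
    have hb : b.right ≠ 1 := hright.not.mpr ha
    rw [← pow_mul, mul_assoc]
    ext1
    · funext x
      rw [wreath_left_pow_natCard_mul, wreath_left_pow_natCard_mul, pow_mul]
      refine h.pow_eq_pow n ?_ ?_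
      · rw [map_wreath_left_pow_natCard φ ha, map_wreath_left_pow_natCard φ hb, hφ]
      · rw [map_wreath_left_pow_natCard ι ha, map_wreath_left_pow_natCard ι hb, hι]
    · rw [wreath_right_pow_natCard_mul, wreath_right_pow_natCard_mul]
  map_eq {a b} hab ha := by
    have har : a.right ≠ 1 := fun har => ha (h.wreath_pow_eq_one hA har)
    have hbr : b.right ≠ 1 := fun hbr => ha (hab.trans (h.wreath_pow_eq_one hA hbr))
    obtain ⟨x, hx⟩ := exists_wreath_left_pow_natCard_mul_ne_one ha
    rw [← map_wreath_left_pow_natCard φ har x, ← map_wreath_left_pow_natCard φ hbr x]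
    refine h.map_eq ?_ ?_
    · rw [← wreath_left_pow_natCard_mul, ← wreath_left_pow_natCard_mul, hab]
    · rwa [← wreath_left_pow_natCard_mul]

/-- Compare the `Nat.card Q`-th powers of `g` and `g * d`. -/
theorem prodHom_eq_one_of_commute (hA : ∀ x : A, x ^ Nat.card Q = 1) (φ : D →* A)
    {g d : D ≀ᵣ Q} (hg : g.right ≠ 1) (hd : d.right = 1) (h : Commute g d) : prodHom φ d = 1 := by
  have hleft : ((g * d) ^ Nat.card Q).left 1 =
      (g ^ Nat.card Q).left 1 * d.left 1 ^ Nat.card Q := by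
    rw [h.mul_pow, RegularWreathProduct.mul_left, wreath_left_pow_of_right_eq_one hd,
      wreath_right_pow_natCard, Pi.mul_apply, inv_one, one_mul, Pi.pow_apply]
  have hmap : prodHom φ (g * d) = prodHom φ g := by
    rw [← map_wreath_left_pow_natCard φ (by simpa [hd]) 1, hleft, map_mul, map_pow, hA, mul_one,
      map_wreath_left_pow_natCard φ hg]
  rwa [map_mul, mul_eq_left] at hmap

/-- On the centralizer of `g`, the homomorphism `prodHom φ` factors through the projection to
`Q`, which is generated by the image of `u`. -/
theorem prodHom_eq_one_of_commute_of_commute (hA : ∀ x : A, x ^ Nat.card Q = 1)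
    (φ : D →* A) {g u a : D ≀ᵣ Q} (hg : g.right ≠ 1) (hu : u.right ≠ 1) (hgu : Commute g u)
    (hga : Commute g a) (hφu : prodHom φ u = 1) : prodHom φ a = 1 := by
  obtain ⟨k, hk⟩ := Submonoid.mem_powers_iff _ _ |>.mp
    (mem_powers_of_prime_card rfl hu (g' := a.right))
  have hbase : (a * (u ^ k)⁻¹).right = 1 := by
    rw [RegularWreathProduct.mul_right, RegularWreathProduct.inv_right, wreath_right_pow, hk,
      mul_inv_cancel]
  simpa [hφu] using
    prodHom_eq_one_of_commute hA φ hg hbase (hga.mul_right (hgu.pow_right k).inv_right)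

/-- Multiplying one coordinate of `u` by the inverse of a coordinate of `u ^ Nat.card Q` makes the
product around the cycle trivial; that coordinate of `u ^ Nat.card Q` commutes with `g`. -/
theorem exists_commute_prodHom_eq_one {g u : D ≀ᵣ Q} (hg : g.right = 1) (hu : u.right ≠ 1)
    (h : Commute g u) (φ : D →* A) (ι : D →* B) :
    ∃ w : D ≀ᵣ Q, Commute g w ∧ prodHom φ w = 1 ∧ prodHom ι w = 1 ∧ w.right ≠ 1 := by
  classical
  have hcoord : Commute (g.left 1) ((u ^ Nat.card Q).left 1) := by
    have hleft := congrFun (congrArg RegularWreathProduct.left (h.pow_right (Nat.card Q)).eq) 1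
    simpa only [RegularWreathProduct.mul_left, Pi.mul_apply, hg, wreath_right_pow_natCard, inv_one,
      one_mul, commute_iff_eq] using hleft
  refine ⟨⟨Pi.mulSingle 1 ((u ^ Nat.card Q).left 1)⁻¹, 1⟩ * u,
    Commute.mul_right ?_ h, ?_, ?_, by simpa⟩
  · ext1
    · funext x
      rcases eq_or_ne x 1 with rfl | hx
      · simpa only [RegularWreathProduct.mul_left, Pi.mul_apply, hg, inv_one, one_mul,
          Pi.mulSingle_eq_same] using hcoord.inv_right.eq
      · simp [hg, Pi.mulSingle_eq_of_ne hx]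
    · simp
  all_goals
    rw [map_mul, prodHom_mulSingle, map_inv, map_wreath_left_pow_natCard _ hu, inv_mul_cancel]

end PrimeOrder

end Wreath

section WreathPlus

variable {D Q A B : Type*} [Group D] [Finite D] [Group Q] [Finite Q] [CommGroup A] [CommGroup B]

theorem isFSZPlus_wreath [Fact (Nat.card Q).Prime] (hA : ∀ x : A, x ^ Nat.card Q = 1)
    (hB : (Nat.card B).Prime) {r : ℕ} {φ : D →* A} {ι : D →* B}
    (h : PowGovernedBy r φ fun y => ι y = 1) : IsFSZPlus (D ≀ᵣ Q) (Nat.card Q * r) := by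
  have := Fintype.ofFinite Q
  intro g
  have hcomm (a : Subgroup.centralizer {g}) : Commute g a :=
    (Subgroup.mem_centralizer_singleton_iff.mp a.2).symm
  refine isFSZ_of_powGovernedBy (ψ := (prodHom ι).comp (Subgroup.subtype _))
    (χ := RegularWreathProduct.rightHom.comp (Subgroup.subtype _)) hB Fact.out
    ((h.wreath hA).restrict _) fun a u ha hφu _ hu => ?_
  by_cases hg : g.right = 1
  · obtain ⟨w, hgw, hw⟩ := exists_commute_prodHom_eq_one hg hu (hcomm u) φ ι
    exact ⟨⟨w, Subgroup.mem_centralizer_singleton_iff.mpr hgw.eq.symm⟩, hw⟩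
  · have hφa := prodHom_eq_one_of_commute_of_commute hA φ hg hu (hcomm u) (hcomm a) hφu
    exact absurd (((h.wreath hA).restrict _).pow_eq_one hφa) ha

theorem isFSZPlus_wreath_prime_pow {p : ℕ} [Fact p.Prime] (hQ : Nat.card Q = p)
    (hA : ∀ x : A, x ^ p = 1) (hB : (Nat.card B).Prime) {j t : ℕ} {φ : D →* A} {ι : D →* B}
    (h : PowGovernedBy (p ^ j) φ fun y => ι y = 1) (ht : j < t) : IsFSZPlus (D ≀ᵣ Q) (p ^ t) := by
  have := Fintype.ofFinite Q
  subst hQ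
  obtain ⟨s, rfl⟩ := Nat.exists_eq_add_of_lt ht
  rcases s with _ | s
  · rw [add_zero, pow_succ']
    exact isFSZPlus_wreath hA hB h
  · refine isFSZPlus_of_pow_eq_one fun a => ?_
    rw [show j + (s + 1) + 1 = j + 1 + 1 + s by ring, pow_add, pow_succ, pow_succ', pow_mul,
      pow_mul, (h.wreath hA).pow_pow_eq_one (hA _), one_pow]

end WreathPlus

open Multiplicative

section GeomSum

variable {p : ℕ} [Fact p.Prime] {R : Type*} [Ring R] [Algebra (ZMod p) R]

open Polynomial in
theorem geom_sum_eq_sub_one_pow (j : ℕ) (T : R) :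
    ∑ i ∈ Finset.range (p ^ j), T ^ i = (T - 1) ^ (p ^ j - 1) := by
  have h : (∑ i ∈ Finset.range (p ^ j), X ^ i : (ZMod p)[X]) = (X - 1) ^ (p ^ j - 1) := by
    have hX : (X - 1 : (ZMod p)[X]) ≠ 0 := X_sub_C_ne_zero 1
    refine mul_right_cancel₀ hX ?_
    rw [geom_sum_mul, ← pow_succ, Nat.sub_add_cancel (Nat.one_le_pow _ _ (NeZero.pos p)),
      sub_pow_char_pow, one_pow]
  simpa using congrArg (aeval T) h

end GeomSum

section Coordinates

variable (p j : ℕ)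

/-- The nilpotent shift `v ↦ (0, v 0, v 1, …)`, which is `b - 1` on the subgroup generated by
`a_2, a_3, …`. -/
def shift : Module.End (ZMod p) (Fin (p ^ j - 1) → ZMod p) where
  toFun v i := if (i : ℕ) = 0 then 0 else v ⟨(i : ℕ) - 1, lt_of_le_of_lt (Nat.sub_le _ _) i.isLt⟩
  map_add' v w := by
    ext i
    by_cases h : (i : ℕ) = 0 <;> simp [h]
  map_smul' c v := by
    ext i
    by_cases h : (i : ℕ) = 0 <;> simp [h]

theorem shift_pow_apply_of_lt (k : ℕ) (v : Fin (p ^ j - 1) → ZMod p) (i : Fin (p ^ j - 1))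
    (hi : (i : ℕ) < k) : (shift p j ^ k) v i = 0 := by
  induction k generalizing i with
  | zero => omega
  | succ k ih =>
    rw [pow_succ', Module.End.mul_apply]
    by_cases h : (i : ℕ) = 0
    · simp [shift, h]
    · simpa [shift, h] using ih _ (by simp; omega)

theorem bHom_zero_left (v : Fin (p ^ j - 1) → ZMod p) :
    bHom p j (0, v) = (0, (1 + shift p j) v) := by
  ext i
  · rfl
  · by_cases h : (i : ℕ) = 0 <;> simp [bHom, shift, h]

theorem bHom_zero_right {x : ZMod (p ^ (j + 1))} (hx : reduce p j x = 0) :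
    bHom p j (x, 0) = (x, 0) := by
  ext i
  · rfl
  · simp [bHom, hx]

theorem bHom_iterate_zero_left (k : ℕ) (v : Fin (p ^ j - 1) → ZMod p) :
    (bHom p j)^[k] (0, v) = (0, ((1 + shift p j) ^ k) v) := by
  induction k with
  | zero => rfl
  | succ k ih =>
    rw [Function.iterate_succ_apply', ih, bHom_zero_left, pow_succ' (1 + shift p j)]
    rfl

theorem bHom_iterate_fst (k : ℕ) (q : QAdd p j) : ((bHom p j)^[k] q).1 = q.1 := by
  induction k with
  | zero => rfl
  | succ k ih => rw [Function.iterate_succ_apply']; exact ih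

theorem bHom_iterate_snd_zero [NeZero (p ^ j - 1)] (k : ℕ) (q : QAdd p j) :
    ((bHom p j)^[k] q).2 0 = q.2 0 - k * reduce p j q.1 := by
  induction k with
  | zero => simp
  | succ k ih =>
    have hstep (q : QAdd p j) : (bHom p j q).2 0 = q.2 0 - reduce p j q.1 := by simp [bHom]
    rw [Function.iterate_succ_apply', hstep, ih, bHom_iterate_fst, Nat.cast_succ]
    ring

variable [Fact p.Prime]

theorem natCast_pow_mul_eq_zero_iff (x : ZMod (p ^ (j + 1))) :
    ((p ^ j : ℕ) : ZMod (p ^ (j + 1))) * x = 0 ↔ reduce p j x = 0 := by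
  obtain ⟨k, rfl⟩ := ZMod.natCast_zmod_surjective x
  rw [map_natCast, ZMod.natCast_eq_zero_iff, ← Nat.cast_mul, ZMod.natCast_eq_zero_iff, pow_succ,
    Nat.mul_dvd_mul_iff_left (pow_pos (NeZero.pos p) j)]

/-- On the subgroup generated by `a_2, a_3, …`, of rank `p ^ j - 1` over `ZMod p`, the sum is the
power `(b - 1) ^ (p ^ j - 1)` of a nilpotent shift. -/
theorem sum_bHom_iterate_eq_zero {q : QAdd p j} (hq : reduce p j q.1 = 0) :
    ∑ i ∈ Finset.range (p ^ j), (bHom p j)^[i] q = 0 := by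
  obtain ⟨x, v⟩ := q
  have hleft : ∑ i ∈ Finset.range (p ^ j), (bHom p j)^[i] (x, 0) = p ^ j • (x, 0) := by
    simp only [Function.iterate_fixed (bHom_zero_right p j hq), Finset.sum_const,
      Finset.card_range]
  have hright : ∑ i ∈ Finset.range (p ^ j), ((1 + shift p j) ^ i) v = 0 := by
    rw [← LinearMap.sum_apply, geom_sum_eq_sub_one_pow, add_sub_cancel_left]
    exact funext fun i => shift_pow_apply_of_lt p j _ v i i.isLt
  have hxv : ((x, v) : QAdd p j) = (x, 0) + (0, v) := by simp
  rw [hxv]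
  simp only [iterate_map_add, Finset.sum_add_distrib, hleft, bHom_iterate_zero_left]
  ext1
  · simpa [Prod.fst_sum] using (natCast_pow_mul_eq_zero_iff p j x).mpr hq
  · simpa [Prod.snd_sum] using hright

theorem bHom_iterate_prime_pow (q : QAdd p j) : (bHom p j)^[p ^ j] q = q := by
  have htelescope := sum_bHom_iterate_eq_zero p j (q := bHom p j q - q) (by simp [bHom])
  simp only [iterate_map_sub, ← Function.iterate_succ_apply] at htelescope
  rwa [Finset.sum_range_sub (fun i => (bHom p j)^[i] q), sub_eq_zero] at htelescope

theorem bAut_pow_apply (k : ℕ) (q : QGroup p j) :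
    (bAut p j ^ k) q = ofAdd ((bHom p j)^[k] q.toAdd) := by
  induction k with
  | zero => rfl
  | succ k ih => rw [pow_succ' (bAut p j), MulAut.mul_apply, ih, Function.iterate_succ_apply']; rfl

theorem bAut_pow_prime_pow : bAut p j ^ p ^ j = 1 := by
  ext1 q
  rw [bAut_pow_apply, bHom_iterate_prime_pow, ofAdd_toAdd, MulAut.one_apply]

end Coordinates

section FGroupPower

variable {p j : ℕ} [Fact p.Prime]

theorem exists_bAut_pow_eq (c : Subgroup.zpowers (bAut p j)) : ∃ k : ℕ, bAut p j ^ k = c :=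
  (Submonoid.mem_powers_iff _ _).mp (mem_powers_iff_mem_zpowers.mpr c.2)

theorem zpowers_bAut_pow_prime_pow (c : Subgroup.zpowers (bAut p j)) : c ^ p ^ j = 1 := by
  obtain ⟨k, hk⟩ := exists_bAut_pow_eq c
  ext1
  rw [Subgroup.coe_pow, ← hk, pow_right_comm, bAut_pow_prime_pow, one_pow, Subgroup.coe_one]

theorem bAut_pow_apply_fst (k : ℕ) (q : QGroup p j) :
    ((bAut p j ^ k) q).toAdd.1 = q.toAdd.1 := by
  rw [bAut_pow_apply, toAdd_ofAdd, bHom_iterate_fst]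

theorem powNorm_bAut_pow_fst (n k : ℕ) (q : QGroup p j) :
    (powNorm n (bAut p j ^ k) q).toAdd.1 = n * q.toAdd.1 := by
  simp only [powNorm_apply, toAdd_prod, Prod.fst_sum, ← pow_mul, bAut_pow_apply_fst,
    Finset.sum_const, Finset.card_range, nsmul_eq_mul]

theorem powNorm_bAut_of_reduce_eq_zero {q : QGroup p j} (hq : reduce p j q.toAdd.1 = 0) :
    powNorm (p ^ j) (bAut p j) q = 1 := by
  simp only [powNorm_apply, bAut_pow_apply]
  exact sum_bHom_iterate_eq_zero p j hq

theorem powNorm_bAut_pow_of_not_dvd {k : ℕ} (hk : ¬p ∣ k) :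
    powNorm (p ^ j) (bAut p j ^ k) = powNorm (p ^ j) (bAut p j) :=
  powNorm_pow_of_coprime (bAut_pow_prime_pow p j)
    (((Fact.out : p.Prime).coprime_iff_not_dvd.mpr hk).symm.pow_right j)

theorem pow_prime_pow_eq_inl {y : FGroup p j} {k : ℕ} (hk : bAut p j ^ k = y.right) :
    y ^ p ^ j = SemidirectProduct.inl (powNorm (p ^ j) (bAut p j ^ k) y.left) := by
  rw [pow_eq_inl_powNorm (zpowers_bAut_pow_prime_pow _), hk, Subgroup.subtype_apply]

variable (p j) in
/-- The homomorphism sending an element of `F(p,j)` to its exponent of `a_1`, modulo `p`. -/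
def expHom : FGroup p j →* Multiplicative (ZMod p) where
  toFun y := ofAdd (reduce p j y.left.toAdd.1)
  map_one' := by simp
  map_mul' y z := by
    obtain ⟨k, hk⟩ := exists_bAut_pow_eq y.right
    simp [← hk, bAut_pow_apply_fst]

variable [NeZero j]

theorem powNorm_bAut_pow_of_dvd {k : ℕ} (hk : p ∣ k) (q : QGroup p j) :
    powNorm (p ^ j) (bAut p j ^ k) q =
      ofAdd (((p ^ j : ℕ) : ZMod (p ^ (j + 1))) * q.toAdd.1, 0) := by
  obtain ⟨i, hi⟩ := Nat.exists_eq_succ_of_ne_zero (NeZero.ne j)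
  have hpow : p ^ j = p ^ i * p := by rw [hi, pow_succ]
  have hperiod : (bAut p j ^ k) ^ p ^ i = 1 := by
    obtain ⟨l, rfl⟩ := hk
    rw [← pow_mul, mul_right_comm, mul_comm p, ← hpow, pow_mul, bAut_pow_prime_pow, one_pow]
  have hnorm : powNorm (p ^ j) (bAut p j ^ k) q = powNorm (p ^ i) (bAut p j ^ k) q ^ p :=
    (congrArg (powNorm · (bAut p j ^ k) q) hpow).trans (powNorm_mul_of_pow_eq_one hperiod p q)
  apply toAdd.injective
  ext1
  · exact powNorm_bAut_pow_fst _ _ _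
  · rw [hnorm, toAdd_pow, toAdd_ofAdd]
    ext1 i
    simp

instance neZeroPrimePowSubOne : NeZero (p ^ j - 1) :=
  ⟨(Nat.sub_pos_of_lt (Nat.one_lt_pow (NeZero.ne j) (Fact.out : p.Prime).one_lt)).ne'⟩

theorem bAut_pow_ofAdd_one_zero (k : ℕ) :
    ((bAut p j ^ k) (ofAdd (1, 0))).toAdd.2 0 = -k := by
  simp [bAut_pow_apply, bHom_iterate_snd_zero]

variable (p j) in
/-- The homomorphism sending an element of `F(p,j)` to its exponent of `b⁻¹`, modulo `p`. The
exponent is read off as the coordinate at `a_2` of the image of `a_1`. -/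
def bExpHom : FGroup p j →* Multiplicative (ZMod p) where
  toFun y := ofAdd ((y.right.1 (ofAdd (1, 0))).toAdd.2 0)
  map_one' := by simp
  map_mul' y z := by
    obtain ⟨k, hk⟩ := exists_bAut_pow_eq y.right
    obtain ⟨l, hl⟩ := exists_bAut_pow_eq z.right
    rw [SemidirectProduct.mul_right, Subgroup.coe_mul, ← hk, ← hl, ← pow_add,
      bAut_pow_ofAdd_one_zero, bAut_pow_ofAdd_one_zero, bAut_pow_ofAdd_one_zero, Nat.cast_add,
      neg_add, ofAdd_add]

theorem bExpHom_eq_one_iff {y : FGroup p j} {k : ℕ} (hk : bAut p j ^ k = y.right) :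
    bExpHom p j y = 1 ↔ p ∣ k := by
  rw [← ZMod.natCast_eq_zero_iff, ← neg_eq_zero, ← bAut_pow_ofAdd_one_zero (p := p) (j := j), hk]
  exact ofAdd_eq_one

theorem powNorm_bAut_pow_of_reduce_eq_zero (k : ℕ) {q : QGroup p j}
    (hq : reduce p j q.toAdd.1 = 0) : powNorm (p ^ j) (bAut p j ^ k) q = 1 := by
  by_cases hk : p ∣ k
  · rw [powNorm_bAut_pow_of_dvd hk, (natCast_pow_mul_eq_zero_iff p j _).mpr hq]
    rfl
  · rw [powNorm_bAut_pow_of_not_dvd hk, powNorm_bAut_of_reduce_eq_zero hq]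

theorem powNorm_bAut_pow_eq_of_dvd_iff {k l : ℕ} (h : p ∣ k ↔ p ∣ l) :
    powNorm (p ^ j) (bAut p j ^ k) = powNorm (p ^ j) (bAut p j ^ l) := by
  by_cases hk : p ∣ k
  · refine MonoidHom.ext fun q => ?_
    rw [powNorm_bAut_pow_of_dvd hk, powNorm_bAut_pow_of_dvd (h.mp hk)]
  · rw [powNorm_bAut_pow_of_not_dvd hk, powNorm_bAut_pow_of_not_dvd (h.not.mp hk)]

theorem powNorm_bAut_pow_eq_of_reduce_eq (k : ℕ) {q q' : QGroup p j}
    (h : reduce p j q.toAdd.1 = reduce p j q'.toAdd.1) :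
    powNorm (p ^ j) (bAut p j ^ k) q = powNorm (p ^ j) (bAut p j ^ k) q' := by
  rw [← div_eq_one, ← map_div]
  exact powNorm_bAut_pow_of_reduce_eq_zero k (by simp [h])

theorem powGovernedBy_expHom :
    PowGovernedBy (p ^ j) (expHom p j) fun y => bExpHom p j y = 1 where
  pow_eq_pow n y z hexp hb := by
    obtain ⟨k, hk⟩ := exists_bAut_pow_eq y.right
    obtain ⟨l, hl⟩ := exists_bAut_pow_eq z.right
    have hdvd : p ∣ l ↔ p ∣ k := by
      rw [← bExpHom_eq_one_iff hk, ← bExpHom_eq_one_iff hl, hb]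
    have hreduce : reduce p j z.left.toAdd.1 = reduce p j (y.left ^ n).toAdd.1 := by
      simpa [expHom, ← ofAdd_nsmul] using hexp
    rw [pow_prime_pow_eq_inl hk, pow_prime_pow_eq_inl hl, powNorm_bAut_pow_eq_of_dvd_iff hdvd,
      powNorm_bAut_pow_eq_of_reduce_eq k hreduce, map_pow, map_pow]
  map_eq {y z} hyz _ := by
    obtain ⟨k, hk⟩ := exists_bAut_pow_eq y.right
    obtain ⟨l, hl⟩ := exists_bAut_pow_eq z.right
    rw [pow_prime_pow_eq_inl hk, pow_prime_pow_eq_inl hl] at hyz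
    have hfst := congrArg (fun q => q.toAdd.1) (SemidirectProduct.inl_injective hyz)
    simp only [powNorm_bAut_pow_fst] at hfst
    have hreduce := (natCast_pow_mul_eq_zero_iff p j (y.left.toAdd.1 - z.left.toAdd.1)).mp
      (by rw [mul_sub, hfst, sub_self])
    rw [map_sub, sub_eq_zero] at hreduce
    exact congrArg ofAdd hreduce

end FGroupPower

end FSZ

theorem mainTheorem8_general (p j t : ℕ) [Fact p.Prime] [NeZero j] (ht : j < t) :
    FSZ.IsFSZPlus (FSZ.FGroup p j ≀ᵣ Multiplicative (ZMod p)) (p ^ t) := by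
  have hcard : Nat.card (Multiplicative (ZMod p)) = p := Nat.card_zmod p
  have hexp (x : Multiplicative (ZMod p)) : x ^ p = 1 := by
    simpa only [hcard] using pow_card_eq_one' (x := x)
  exact FSZ.isFSZPlus_wreath_prime_pow hcard hexp (hcard.symm ▸ Fact.out)
    FSZ.powGovernedBy_expHom ht

theorem mainTheorem8 (p : ℕ) [Fact p.Prime] (t : ℕ) (ht : 1 < t) :
    FSZ.IsFSZPlus (FSZ.FGroup p 1 ≀ᵣ Multiplicative (ZMod p)) (p ^ t) :=
  mainTheorem8_general p 1 t ht
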